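/- Consider a stochastic linear bandit with $K\ge 1$ arms with feature vectors $x_1,\dots,x_K\in\mathbb R^d$, an unknown parameter $\theta_*\in\mathbb R^d$ and a horizon of $n\ge 2$ rounds. The reward $Y_{i,t}$ that arm $i\in[K]$ yields if it is pulled in round $t\in[n]$ has law $\mathcal N(x_i^\top\theta_*,\sigma^2)$, and all the $Y_{i,t}$ are independent. Let $z\in(0,1)$, $\alpha>0$, $\lambda>0$, and let $$T=\frac{4\log n}{z-1-\log z}+1 .$$ Arms are pulled by the algorithm LinCORe. In round $t\le\max\{d,T\}$ it pulls the arms cyclically: $I_t\equiv t \pmod K$. In round $t>\max\{d,T\}$, let $Y_\ell=Y_{I_\ell,\ell}$ and $X_\ell=x_{I_\ell}$ for $\ell<t$ denote the past observed rewards and the features of the pulled arms, let $\mu_t=\frac1{t-1}\sum_{\ell=1}^{t-1}Y_\ell$, and let the reward pool $\mathcal R_t$ be the list of the $2(t-1)$ numbers $\alpha(Y_\ell-\mu_t)$ and $\alpha(\mu_t-Y_\ell)$, $\ell=1,\dots,t-1$. The algorithm draws $Z_1,\dots,Z_{t-1}$ i.i.d. uniformly from $\mathcal R_t$ (with fresh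 randomness, independent of the rewards and of the earlier draws), computes $$\tilde\theta_t=\Big(\sum_{\ell=1}^{t-1}X_\ell X_\ell^\top+\lambda I_d\Big)^{-1}\sum_{\ell=1}^{t-1}X_\ell\,(Y_\ell+Z_\ell),$$ and pulls an arm $I_t$ that maximizes $x_i^\top\tilde\theta_t$ over $i\in[K]$, where ties are broken by an arbitrary rule fixed in advance. For every round $t\ge 2$ (including initialization rounds) let $\mathcal R_t$ be defined by the same formula, and let $\sigma^2(\mathcal R_t)$ be the variance of one number drawn uniformly from $\mathcal R_t$, that is, $$\sigma^2(\mathcal R_t)=\frac{\alpha^2}{t-1}\sum_{\ell=1}^{t-1}(Y_\ell-\mu_t)^2 .$$ Then, with probability at least $1-\frac1n$, $$\sigma^2(\mathcal R_t)\ \ge\ \frac{\alpha^2 z}{2}\,\sigma^2\qquad\text{jointly for all rounds } t\in\{3,\dots,n\}\text{ with } t>T .$$ -/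

import Mathlib

open MeasureTheory ProbabilityTheory
open scoped NNReal Matrix

noncomputable section

namespace LinCORe

/-- The number `4 log n / (z - 1 - log z) + 1`, which determines the length of the
initialization phase. -/
def initLength (n : ℕ) (z : ℝ) : ℝ :=
  4 * Real.log n / (z - 1 - Real.log z) + 1

/-- The observations of the first `m` rounds: for each of them the pulled arm and the observed
reward. The entry `ℓ : Fin m` belongs to round `ℓ + 1`. Arms are numbered `0, …, K - 1`. -/
abbrev History (K m : ℕ) : Type := Fin m → Fin K × ℝ

/-- The mean of all observed rewards. -/
def rewardMean {K m : ℕ} (h : History K m) : ℝ :=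
  (∑ ℓ, (h ℓ).2) / m

/-- The reward pool built from `m` past observations, a family of `2 m` numbers: each past reward
`Y` contributes the two entries `α (Y - mean)` and `α (mean - Y)`. -/
def rewardPool {K m : ℕ} (α : ℝ) (h : History K m) : Fin m × Bool → ℝ :=
  fun p => if p.2 then α * (rewardMean h - (h p.1).2) else α * ((h p.1).2 - rewardMean h)

/-- The mean of one entry drawn uniformly at random from a finite family of numbers. -/
def drawMean {ι : Type*} [Fintype ι] (R : ι → ℝ) : ℝ :=
  (∑ i, R i) / Fintype.card ι

/-- The variance of one entry drawn uniformly at random from a finite family of numbers. -/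
def drawVariance {ι : Type*} [Fintype ι] (R : ι → ℝ) : ℝ :=
  (∑ i, (R i - drawMean R) ^ 2) / Fintype.card ι

/-- The regularized sample covariance matrix `G = ∑ ℓ, X_ℓ X_ℓᵀ + lam • I`. -/
def gram {K d m : ℕ} (x : Fin K → Fin d → ℝ) (lam : ℝ) (h : History K m) :
    Matrix (Fin d) (Fin d) ℝ :=
  ∑ ℓ, Matrix.vecMulVec (x (h ℓ).1) (x (h ℓ).1) + lam • (1 : Matrix (Fin d) (Fin d) ℝ)

/-- The perturbed estimate `G⁻¹ ∑ ℓ, X_ℓ (Y_ℓ + Z_ℓ)`. -/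
def perturbedEstimate {K d m : ℕ} (x : Fin K → Fin d → ℝ) (lam : ℝ) (h : History K m)
    (Z : Fin m → ℝ) : Fin d → ℝ :=
  (gram x lam h)⁻¹ *ᵥ ∑ ℓ, ((h ℓ).2 + Z ℓ) • x (h ℓ).1

open Classical in
/-- The arms with the largest estimated mean reward. -/
def bestArms {K d : ℕ} (x : Fin K → Fin d → ℝ) (θ : Fin d → ℝ) : Finset (Fin K) :=
  Finset.univ.filter fun i => ∀ j, x j ⬝ᵥ θ ≤ x i ⬝ᵥ θ

/-- The arm pulled in round `m + 1`, given the `m` past observations `h` and the positions `J` of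
the `m` draws from the reward pool. During initialization the arms are pulled cyclically.
Afterwards an arm with the largest perturbed estimate is pulled; `tie t s` is the arm pulled in
round `t` when `s` is the set of maximizers. -/
def nextArm {K d : ℕ} [NeZero K] (x : Fin K → Fin d → ℝ) (n : ℕ) (z α lam : ℝ)
    (tie : ℕ → Finset (Fin K) → Fin K) {m : ℕ} (h : History K m) (J : Fin m → Fin m × Bool) :
    Fin K :=
  open Classical in
  if ((m + 1 : ℕ) : ℝ) ≤ max (d : ℝ) (initLength n z) then Fin.ofNat K m
  else tie (m + 1) (bestArms x (perturbedEstimate x lam h fun ℓ => rewardPool α h (J ℓ)))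

/-- The observations of the first `m` rounds of the algorithm, when `y i t` is the reward that
arm `i` yields if pulled in round `t` (`t = 1, 2, …`), and `J m ℓ` is the position in the
reward pool of the `ℓ`-th draw made after `m` observations, that is, in round `m + 1`. -/
def history {K d : ℕ} [NeZero K] (x : Fin K → Fin d → ℝ) (n : ℕ) (z α lam : ℝ)
    (tie : ℕ → Finset (Fin K) → Fin K) (y : Fin K → ℕ → ℝ)
    (J : (m : ℕ) → Fin m → Fin m × Bool) : (m : ℕ) → History K m
  | 0 => Fin.elim0
  | m + 1 =>
    let h := history x n z α lam tie y J m
    let a := nextArm x n z α lam tie h (J m)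
    Fin.snoc (α := fun _ => Fin K × ℝ) h (a, y a (m + 1))

/-- The reward pool of round `t`, built from the observations of the first `t - 1` rounds. -/
def roundPool {K d : ℕ} [NeZero K] (x : Fin K → Fin d → ℝ) (n : ℕ) (z α lam : ℝ)
    (tie : ℕ → Finset (Fin K) → Fin K) (y : Fin K → ℕ → ℝ)
    (J : (m : ℕ) → Fin m → Fin m × Bool) (t : ℕ) : Fin (t - 1) × Bool → ℝ :=
  rewardPool α (history x n z α lam tie y J (t - 1))

end LinCORe

end

/-! Write `S_m` for the sum of squared deviations of the first `m` rewards and `v = σ²`. The pool is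
symmetric, so its variance is `α² S_m / m`, and the claim is that `S_m ≥ m z v / 2` for all relevant
`m = t - 1`.

The draws are independent of the rewards and take finitely many values, so they may be frozen
(`measure_le_of_indepFun_fintype`). Then the arm of round `m + 1` is a function of the past, and the
new reward is Gaussian with variance `v` and a predictable mean. The update `S_(m+1) = S_m + m/(m+1)
(Y - mean)²` is smallest in law when `Y` is centred at the old mean, so a bound uniform in the
Gaussian mean makes the arm selection irrelevant (`lintegral_history_mul_le`).

Consequently `N_m = exp (m(1-z)/2 - (1-z)/(zv) S_m)` is a supermartingale: each step costs at most a
factor `√L`, where `L = z e^(1-z) ≤ 1`. A violation at time `m` forces `N_m ≥ 1`, so Ville's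
inequality (`lintegral_hitting_le`) bounds all violations from time `k` on by `E N_k`, roughly
`L^(k/2)`. The condition `t > T` says `n⁴ L^m < 1`, which yields `1/n` when the first relevant `k`
is at least `3`. For `k = 2` the exponential bound is too weak; times `2` and `3` are treated by
bounding the Gaussian density (`measure_sumSqDev_two_lt_le`), and Ville's inequality takes over at
time `4`. -/

namespace LinCORe

open scoped ENNReal

/-! ### Sums of squared deviations and the pool variance -/

/-- The sum of the squared deviations of the observed rewards from their mean. -/
noncomputable def sumSqDev {K m : ℕ} (h : History K m) : ℝ :=
  ∑ ℓ, ((h ℓ).2 - rewardMean h) ^ 2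

lemma sumSqDev_nonneg {K m : ℕ} (h : History K m) : 0 ≤ sumSqDev h :=
  Finset.sum_nonneg fun _ _ => sq_nonneg _

lemma sumSqDev_eq {K m : ℕ} (hm : 0 < m) (h : History K m) :
    sumSqDev h = ∑ ℓ, (h ℓ).2 ^ 2 - (∑ ℓ, (h ℓ).2) ^ 2 / m := by
  have hm' : (m : ℝ) ≠ 0 := by positivity
  simp only [sumSqDev, rewardMean, sub_sq, Finset.sum_add_distrib, Finset.sum_sub_distrib,
    ← Finset.sum_mul, ← Finset.mul_sum, Finset.sum_const, Finset.card_univ, Fintype.card_fin,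
    nsmul_eq_mul]
  field_simp
  ring

/-- Welford's update: the new reward enters only through its deviation from the old mean, which is
known before the reward is seen. In particular `sumSqDev` never decreases. -/
lemma sumSqDev_snoc {K m : ℕ} (hm : 0 < m) (h : History K m) (p : Fin K × ℝ) :
    sumSqDev (Fin.snoc (α := fun _ => Fin K × ℝ) h p : History K (m + 1)) =
      sumSqDev h + m / (m + 1) * (p.2 - rewardMean h) ^ 2 := by
  have hm' : (m : ℝ) ≠ 0 := by positivity
  have hm1 : (m : ℝ) + 1 ≠ 0 := by positivity
  rw [sumSqDev_eq hm, sumSqDev_eq m.succ_pos, rewardMean]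
  simp only [Fin.sum_univ_castSucc, Fin.snoc_castSucc, Fin.snoc_last]
  push_cast
  field_simp
  ring

lemma sumSqDev_one {K : ℕ} (h : History K 1) : sumSqDev h = 0 := by
  simp [sumSqDev, rewardMean]

lemma drawMean_rewardPool {K m : ℕ} (α : ℝ) (h : History K m) :
    drawMean (rewardPool α h) = 0 := by
  simp [drawMean, rewardPool, Fintype.sum_prod_type, ← mul_add]

lemma drawVariance_rewardPool {K m : ℕ} (α : ℝ) (h : History K m) :
    drawVariance (rewardPool α h) = α ^ 2 * sumSqDev h / m := by
  have hs : ∑ p, (rewardPool α h p) ^ 2 = 2 * (α ^ 2 * sumSqDev h) := by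
    simp only [rewardPool, Fintype.sum_prod_type, Fintype.sum_bool, sumSqDev, Finset.mul_sum]
    refine Finset.sum_congr rfl fun ℓ _ => ?_
    simp only [if_true, Bool.false_eq_true, if_false]
    ring
  simp only [drawVariance, drawMean_rewardPool, sub_zero, hs, Fintype.card_prod,
    Fintype.card_fin, Fintype.card_bool, Nat.cast_mul, Nat.cast_ofNat]
  rw [mul_comm (m : ℝ), mul_div_mul_left _ _ two_ne_zero]

/-! ### Measurability of the history for fixed draws -/

section

variable {K d : ℕ} [NeZero K] (x : Fin K → Fin d → ℝ) (n : ℕ) (z α lam : ℝ)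
  (tie : ℕ → Finset (Fin K) → Fin K)

lemma history_succ (y : Fin K → ℕ → ℝ) (J : (m : ℕ) → Fin m → Fin m × Bool) (m : ℕ) :
    history x n z α lam tie y J (m + 1) =
      Fin.snoc (α := fun _ => Fin K × ℝ) (history x n z α lam tie y J m)
        (nextArm x n z α lam tie (history x n z α lam tie y J m) (J m),
          y (nextArm x n z α lam tie (history x n z α lam tie y J m) (J m)) (m + 1)) := rfl

/-- The first `m` observations depend only on the rewards and the draws of the first `m` rounds. -/
lemma history_congr {y y' : Fin K → ℕ → ℝ} {J J' : (m : ℕ) → Fin m → Fin m × Bool} (m : ℕ)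
    (hy : ∀ i, ∀ s < m, y i (s + 1) = y' i (s + 1)) (hJ : ∀ s < m, J s = J' s) :
    history x n z α lam tie y J m = history x n z α lam tie y' J' m := by
  induction m with
  | zero => rfl
  | succ m ih =>
    have h := ih (fun i s hs => hy i s (by omega)) fun s hs => hJ s (by omega)
    rw [history_succ, history_succ, h, hJ m (by omega), hy _ m (by omega)]

omit [NeZero K] in
lemma measurable_rewardMean {m : ℕ} : Measurable (rewardMean : History K m → ℝ) := by
  unfold rewardMean
  fun_prop

omit [NeZero K] in
lemma measurable_sumSqDev {m : ℕ} : Measurable (sumSqDev : History K m → ℝ) := by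
  have := measurable_rewardMean (K := K) (m := m)
  unfold sumSqDev
  fun_prop

omit [NeZero K] in
lemma measurable_rewardPool {m : ℕ} (p : Fin m × Bool) :
    Measurable fun h : History K m => rewardPool α h p := by
  have := measurable_rewardMean (K := K) (m := m)
  unfold rewardPool
  split_ifs <;> fun_prop

-- The Gram matrix depends only on the pulled arms, which take finitely many values. The estimate is
-- thus a sum of measurable scalars with discrete coefficients, and no regularity of the matrix
-- inverse is needed.
omit [NeZero K] in
lemma measurable_perturbedEstimate {m : ℕ} (J : Fin m → Fin m × Bool) (i : Fin d) :
    Measurable fun h : History K m =>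
      perturbedEstimate x lam h (fun ℓ => rewardPool α h (J ℓ)) i := by
  have harms : Measurable fun (h : History K m) (ℓ : Fin m) => (h ℓ).1 := by fun_prop
  have hw : ∀ ℓ, Measurable fun h : History K m => ((gram x lam h)⁻¹ *ᵥ x (h ℓ).1) i := fun ℓ =>
    Measurable.comp (g := fun a : Fin m → Fin K =>
      ((gram x lam fun ℓ => (a ℓ, (0 : ℝ)))⁻¹ *ᵥ x (a ℓ)) i) Measurable.of_discrete harms
  have hp : ∀ ℓ, Measurable fun h : History K m => (h ℓ).2 + rewardPool α h (J ℓ) := fun ℓ =>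
    (measurable_snd.comp (measurable_pi_apply ℓ)).add (measurable_rewardPool α (J ℓ))
  have heq : ∀ h : History K m,
      perturbedEstimate x lam h (fun ℓ => rewardPool α h (J ℓ)) i =
      ∑ ℓ, ((h ℓ).2 + rewardPool α h (J ℓ)) * ((gram x lam h)⁻¹ *ᵥ x (h ℓ).1) i := fun h => by
    simp only [perturbedEstimate, Matrix.mulVec_sum, Matrix.mulVec_smul, Finset.sum_apply,
      Pi.smul_apply, smul_eq_mul]
  simp only [heq]
  exact Finset.measurable_sum _ fun ℓ _ => (hp ℓ).mul (hw ℓ)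

lemma measurable_nextArm {m : ℕ} (J : Fin m → Fin m × Bool) :
    Measurable fun h : History K m => nextArm x n z α lam tie h J := by
  unfold nextArm
  split_ifs
  · exact measurable_const
  have hest := measurable_perturbedEstimate (m := m) x α lam J
  have hR : Measurable fun (h : History K m) (p : Fin K × Fin K) =>
      x p.1 ⬝ᵥ perturbedEstimate x lam h (fun ℓ => rewardPool α h (J ℓ)) ≤
        x p.2 ⬝ᵥ perturbedEstimate x lam h (fun ℓ => rewardPool α h (J ℓ)) := by
    have hdot : ∀ k : Fin K, Measurable fun h : History K m =>
        x k ⬝ᵥ perturbedEstimate x lam h (fun ℓ => rewardPool α h (J ℓ)) := fun k =>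
      Finset.measurable_sum _ fun i _ => (hest i).const_mul _
    exact measurable_pi_iff.2 fun p =>
      measurableSet_setOfPred.1 (measurableSet_le (hdot p.1) (hdot p.2))
  -- The set of maximizers is determined by the finitely many truth values of pairwise comparisons,
  -- so an arbitrary tie rule is measurable.
  exact Measurable.comp (g := fun R : Fin K × Fin K → Prop => tie (m + 1)
    (open Classical in Finset.univ.filter fun i => ∀ j, R (j, i))) Measurable.of_discrete hR

lemma measurable_history {Ω : Type*} [MeasurableSpace Ω] {y : Fin K → ℕ → Ω → ℝ}
    (hy : ∀ i s, Measurable (y i s)) (J : (m : ℕ) → Fin m → Fin m × Bool) (m : ℕ) :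
    Measurable fun ω => history x n z α lam tie (fun i s => y i s ω) J m := by
  induction m with
  | zero => exact measurable_const
  | succ m ih =>
    have hA : Measurable fun ω =>
        nextArm x n z α lam tie (history x n z α lam tie (fun i s => y i s ω) J m) (J m) :=
      (measurable_nextArm x n z α lam tie (J m)).comp ih
    have hyA : Measurable fun p : Fin K × Ω => y p.1 (m + 1) p.2 :=
      measurable_from_prod_countable_right fun i => hy i (m + 1)
    refine measurable_pi_iff.2 fun ℓ => ?_
    simp only [history_succ]
    refine Fin.lastCases ?_ (fun ℓ => ?_) ℓ
    · simp only [Fin.snoc_last]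
      exact hA.prodMk (hyA.comp (hA.prodMk measurable_id))
    · simp only [Fin.snoc_castSucc]
      exact (measurable_pi_apply ℓ).comp ih

end

/-! ### Gaussian estimates uniform in the mean -/

/-- A Gaussian density times `exp (-c (y - b)² / v)` is at most a multiple of another Gaussian
density. -/
lemma exp_mul_gaussianPDFReal_le {v : ℝ≥0} (hv : v ≠ 0) {c : ℝ≥0} (μ b y : ℝ) :
    Real.exp (-(c / v * (y - b) ^ 2)) * gaussianPDFReal μ v y ≤
      (√(1 + 2 * c))⁻¹ *
        gaussianPDFReal ((μ + 2 * c * b) / (1 + 2 * c)) (v / (1 + 2 * c)) y := by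
  have hv' : (0 : ℝ) < v := by positivity
  have hc : (0 : ℝ) ≤ c := c.2
  have hA : (0 : ℝ) < 1 + 2 * c := by positivity
  have hsq : √(2 * Real.pi * (v / (1 + 2 * c : ℝ))) =
      √(2 * Real.pi * v) * (√(1 + 2 * c))⁻¹ := by
    rw [← mul_div_assoc, Real.sqrt_div (by positivity), div_eq_mul_inv]
  have hs : √(1 + 2 * (c : ℝ)) ≠ 0 := (Real.sqrt_pos.2 hA).ne'
  simp only [gaussianPDFReal, NNReal.coe_div, NNReal.coe_add, NNReal.coe_one, NNReal.coe_mul,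
    NNReal.coe_ofNat]
  rw [hsq, mul_inv, inv_inv, mul_left_comm, ← Real.exp_add, ← mul_assoc,
    mul_comm ((√(1 + 2 * (c : ℝ)))⁻¹), mul_assoc (√(2 * Real.pi * v))⁻¹, mul_inv_cancel₀ hs,
    mul_one]
  refine mul_le_mul_of_nonneg_left (Real.exp_le_exp.2 ?_) (by positivity)
  -- Completing the square; the discarded remainder is nonnegative and vanishes exactly when `c = 0`
  -- or `b = μ`.
  have key : -(y - (μ + 2 * c * b) / (1 + 2 * c)) ^ 2 / (2 * (v / (1 + 2 * c : ℝ))) -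
      (-(c / v * (y - b) ^ 2) + -(y - μ) ^ 2 / (2 * v)) =
      c * (μ - b) ^ 2 / (v * (1 + 2 * c)) := by
    field_simp
    ring
  have : 0 ≤ c * (μ - b) ^ 2 / (v * (1 + 2 * c)) := by positivity
  linarith

lemma lintegral_exp_gaussianReal_le {v : ℝ≥0} (hv : v ≠ 0) (c : ℝ≥0) (μ b : ℝ) :
    ∫⁻ y, ENNReal.ofReal (Real.exp (-(c / v * (y - b) ^ 2))) ∂gaussianReal μ v ≤
      ENNReal.ofReal (√(1 + 2 * c))⁻¹ := by
  have hv2 : v / (1 + 2 * c) ≠ 0 := by positivity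
  rw [gaussianReal_of_var_ne_zero μ hv,
    lintegral_withDensity_eq_lintegral_mul _ (measurable_gaussianPDF μ v) (by fun_prop)]
  calc _ ≤ ∫⁻ y, ENNReal.ofReal (√(1 + 2 * c))⁻¹ *
        gaussianPDF ((μ + 2 * c * b) / (1 + 2 * c)) (v / (1 + 2 * c)) y := by
        refine lintegral_mono fun y => ?_
        simp only [Pi.mul_apply, gaussianPDF]
        rw [← ENNReal.ofReal_mul (gaussianPDFReal_nonneg _ _ _),
          ← ENNReal.ofReal_mul (by positivity), mul_comm]
        exact ENNReal.ofReal_le_ofReal (exp_mul_gaussianPDFReal_le hv μ b y)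
    _ = _ := by
        rw [lintegral_const_mul _ (measurable_gaussianPDF _ _),
          lintegral_gaussianPDF_eq_one _ hv2, mul_one]

lemma gaussianReal_ball_le {v : ℝ≥0} (hv : v ≠ 0) (μ b r : ℝ) :
    gaussianReal μ v (Metric.ball b r) ≤ ENNReal.ofReal ((√(2 * Real.pi * v))⁻¹ * (2 * r)) := by
  rw [gaussianReal_apply μ hv]
  calc _ ≤ ∫⁻ _ in Metric.ball b r, ENNReal.ofReal (√(2 * Real.pi * v))⁻¹ := by
        refine lintegral_mono fun y => ENNReal.ofReal_le_ofReal ?_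
        refine mul_le_of_le_one_right (by positivity) (Real.exp_le_one_iff.2 ?_)
        exact div_nonpos_of_nonpos_of_nonneg (neg_nonpos.2 (sq_nonneg _)) (by positivity)
    _ = _ := by
        rw [setLIntegral_const, Real.volume_ball, ← ENNReal.ofReal_mul (by positivity)]

/-! ### One-step and maximal inequalities under adaptive sampling -/

section

variable {K d : ℕ} [NeZero K] {x : Fin K → Fin d → ℝ} {θ : Fin d → ℝ} {v : ℝ≥0} {n : ℕ}
  {z α lam : ℝ} {tie : ℕ → Finset (Fin K) → Fin K}
  {Ω : Type*} [MeasurableSpace Ω] {P : Measure Ω} [IsProbabilityMeasure P]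
  {Y : Fin K → ℕ → Ω → ℝ} {J : (m : ℕ) → Fin m → Fin m × Bool}

omit [IsProbabilityMeasure P] in
/-- For fixed draws, the rewards of round `m + 1` are independent of the first `m`
observations. -/
lemma indepFun_history (hY : ∀ i s, Measurable (Y i s))
    (hY_indep : iIndepFun (fun p : Fin K × Fin n => Y p.1 (p.2 + 1)) P)
    {m : ℕ} (hm : m < n) (a : Fin K) :
    IndepFun (fun ω => history x n z α lam tie (fun i s => Y i s ω) J m) (Y a (m + 1)) P := by
  classical
  let S : Finset (Fin K × Fin n) := Finset.univ.filter fun p => p.2.val < m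
  let T : Finset (Fin K × Fin n) := {(a, ⟨m, hm⟩)}
  have hST : Disjoint S T := by simp [S, T]
  have hind := hY_indep.indepFun_finset S T hST fun p => hY _ _
  -- A reward table rebuilt from the coordinates of the first `m` rounds only. The default `0` is
  -- never read by the first `m` observations.
  let y : Fin K → ℕ → (S → ℝ) → ℝ := fun i s e =>
    if h : ∃ r : Fin n, r.val + 1 = s ∧ r.val < m then
      e ⟨(i, h.choose), by simpa [S] using h.choose_spec.2⟩ else 0
  have hy : ∀ i s, Measurable (y i s) := fun i s => by
    by_cases h : ∃ r : Fin n, r.val + 1 = s ∧ r.val < m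
    · simp only [y, h, dif_pos]
      exact measurable_pi_apply _
    · simp only [y, h, dif_neg, not_false_iff]
      exact measurable_const
  have hcomp := hind.comp (measurable_history x n z α lam tie hy J m)
    (measurable_pi_apply (⟨(a, ⟨m, hm⟩), Finset.mem_singleton_self _⟩ : T))
  suffices heq : (fun ω => history x n z α lam tie (fun i s => Y i s ω) J m) =
      (fun e => history x n z α lam tie (fun i s => y i s e) J m) ∘
        fun ω (i : S) => Y i.1.1 (i.1.2 + 1) ω by
    rw [heq]
    exact hcomp
  funext ω
  refine history_congr x n z α lam tie m (fun i s hs => ?_) fun _ _ => rfl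
  have h : ∃ r : Fin n, r.val + 1 = s + 1 ∧ r.val < m := ⟨⟨s, hs.trans hm⟩, rfl, hs⟩
  have h1 := h.choose_spec.1
  simp only [y, h, dif_pos]
  rw [h1]

/-- If the shifted kernel `g` has integral at most `C` under the law of every arm, then
multiplying a function of the first `m` observations by `g` of the next deviation from the mean
changes its expectation at most by the factor `C`. -/
lemma lintegral_history_mul_le (hY : ∀ i s, Measurable (Y i s))
    (hY_law : ∀ (i : Fin K) (s : Fin n), HasLaw (Y i (s + 1)) (gaussianReal (x i ⬝ᵥ θ) v) P)
    (hY_indep : iIndepFun (fun p : Fin K × Fin n => Y p.1 (p.2 + 1)) P)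
    {m : ℕ} (hm : m < n) {F : History K m → ℝ≥0∞} (hF : Measurable F) {g : ℝ → ℝ≥0∞}
    (hg : Measurable g) {C : ℝ≥0∞}
    (hC : ∀ μ b, ∫⁻ y, g (y - b) ∂gaussianReal μ v ≤ C) :
    ∫⁻ ω, F (history x n z α lam tie (fun i s => Y i s ω) J m) *
        g ((history x n z α lam tie (fun i s => Y i s ω) J (m + 1) (Fin.last m)).2 -
          rewardMean (history x n z α lam tie (fun i s => Y i s ω) J m)) ∂P ≤
      C * ∫⁻ ω, F (history x n z α lam tie (fun i s => Y i s ω) J m) ∂P := by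
  classical
  set h : Ω → History K m := fun ω => history x n z α lam tie (fun i s => Y i s ω) J m with hh
  have hmeas : Measurable h := measurable_history x n z α lam tie hY J m
  let A : History K m → Fin K := fun h => nextArm x n z α lam tie h (J m)
  have hA : Measurable A := measurable_nextArm x n z α lam tie (J m)
  -- Splitting by the pulled arm replaces the adaptive reward by the reward of a fixed arm, which is
  -- independent of the past.
  let G : Fin K → History K m → ℝ≥0∞ := fun a h => (A ⁻¹' {a}).indicator F h
  have hG : ∀ a, Measurable (G a) := fun a => hF.indicator (hA (measurableSet_singleton a))
  have hsum : ∀ h, F h = ∑ a, G a h := fun h => by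
    simp [G, Set.indicator_apply]
  have hmean := measurable_rewardMean (K := K) (m := m)
  have hterm : ∀ a, ∫⁻ ω, G a (h ω) * g (Y a (m + 1) ω - rewardMean (h ω)) ∂P ≤
      C * ∫⁻ ω, G a (h ω) ∂P := fun a => by
    have hpair := (indepFun_iff_map_prod_eq_prod_map_map hmeas.aemeasurable
      (hY a (m + 1)).aemeasurable).1 (indepFun_history (x := x) (z := z) (α := α) (lam := lam)
        (tie := tie) (J := J) hY hY_indep hm a)
    have hlaw := (hY_law a ⟨m, hm⟩).map_eq
    have hmG : Measurable fun p : History K m × ℝ => G a p.1 * g (p.2 - rewardMean p.1) :=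
      ((hG a).comp measurable_fst).mul
        (hg.comp (measurable_snd.sub (hmean.comp measurable_fst)))
    have : IsProbabilityMeasure (P.map h) := Measure.isProbabilityMeasure_map hmeas.aemeasurable
    calc _ = ∫⁻ p, G a p.1 * g (p.2 - rewardMean p.1)
          ∂(P.map fun ω => (h ω, Y a (m + 1) ω)) :=
          (lintegral_map hmG (hmeas.prodMk (hY a (m + 1)))).symm
      _ = ∫⁻ u, ∫⁻ y, G a u * g (y - rewardMean u) ∂gaussianReal (x a ⬝ᵥ θ) v ∂(P.map h) := by
          rw [hpair, hlaw, lintegral_prod _ hmG.aemeasurable]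
      _ ≤ ∫⁻ u, C * G a u ∂(P.map h) := by
          refine lintegral_mono fun u => ?_
          have hgu : Measurable fun y => g (y - rewardMean u) :=
            hg.comp (measurable_id.sub_const _)
          rw [lintegral_const_mul _ hgu, mul_comm C]
          gcongr
          exact hC _ _
      _ = _ := by rw [lintegral_const_mul _ (hG a), lintegral_map (hG a) hmeas]
  have hlast : ∀ ω, F (h ω) * g ((history x n z α lam tie (fun i s => Y i s ω) J (m + 1)
      (Fin.last m)).2 - rewardMean (h ω)) =
      ∑ a, G a (h ω) * g (Y a (m + 1) ω - rewardMean (h ω)) := fun ω => by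
    simp [G, A, Set.indicator_apply, history_succ, ite_mul, hh]
  calc _ = ∑ a, ∫⁻ ω, G a (h ω) * g (Y a (m + 1) ω - rewardMean (h ω)) ∂P := by
        rw [lintegral_congr hlast]
        exact lintegral_finsetSum _ fun a _ => ((hG a).comp hmeas).mul
          (hg.comp ((hY a (m + 1)).sub (hmean.comp hmeas)))
    _ ≤ ∑ a, C * ∫⁻ ω, G a (h ω) ∂P := Finset.sum_le_sum fun a _ => hterm a
    _ = _ := by
        rw [← Finset.mul_sum, lintegral_congr fun ω => hsum (h ω)]
        exact congrArg _ (lintegral_finsetSum _ fun a _ => (hG a).comp hmeas).symm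

omit [IsProbabilityMeasure P] in
/-- Ville's inequality for a nonnegative process `N` adapted to the observations: if it is a
supermartingale from time `k` to time `k + l`, then the probability that it reaches `1` in this
period is at most its expectation at time `k`. -/
lemma lintegral_hitting_le (hY : ∀ i s, Measurable (Y i s))
    {N : (m : ℕ) → History K m → ℝ≥0∞} (hN : ∀ m, Measurable (N m)) (l k : ℕ)
    (hstep : ∀ m, k ≤ m → m < k + l → ∀ F : History K m → ℝ≥0∞, Measurable F →
      ∫⁻ ω, F (history x n z α lam tie (fun i s => Y i s ω) J m) *
        N (m + 1) (history x n z α lam tie (fun i s => Y i s ω) J (m + 1)) ∂P ≤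
      ∫⁻ ω, F (history x n z α lam tie (fun i s => Y i s ω) J m) *
        N m (history x n z α lam tie (fun i s => Y i s ω) J m) ∂P)
    {F : History K k → ℝ≥0∞} (hF : Measurable F) :
    ∫⁻ ω in {ω | ∃ m, k ≤ m ∧ m ≤ k + l ∧
        1 ≤ N m (history x n z α lam tie (fun i s => Y i s ω) J m)},
        F (history x n z α lam tie (fun i s => Y i s ω) J k) ∂P ≤
      ∫⁻ ω, F (history x n z α lam tie (fun i s => Y i s ω) J k) *
        N k (history x n z α lam tie (fun i s => Y i s ω) J k) ∂P := by
  classical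
  set H : (m : ℕ) → Ω → History K m :=
    fun m ω => history x n z α lam tie (fun i s => Y i s ω) J m with hH
  have hHm : ∀ m, Measurable (H m) := fun m => measurable_history x n z α lam tie hY J m
  change ∫⁻ ω in {ω | ∃ m, k ≤ m ∧ m ≤ k + l ∧ 1 ≤ N m (H m ω)}, F (H k ω) ∂P ≤
    ∫⁻ ω, F (H k ω) * N k (H k ω) ∂P
  have hE : ∀ m, MeasurableSet {ω | 1 ≤ N m (H m ω)} := fun m =>
    measurableSet_le measurable_const ((hN m).comp (hHm m))
  have hset : ∀ k l, MeasurableSet {ω | ∃ m, k ≤ m ∧ m ≤ k + l ∧ 1 ≤ N m (H m ω)} := fun k l => by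
    have : {ω | ∃ m, k ≤ m ∧ m ≤ k + l ∧ 1 ≤ N m (H m ω)} =
        ⋃ m ∈ Set.Icc k (k + l), {ω | 1 ≤ N m (H m ω)} := by
      ext ω; simp [and_assoc]
    rw [this]
    exact MeasurableSet.biUnion (Set.to_countable _) fun m _ => hE m
  induction l generalizing k with
  | zero =>
    rw [← lintegral_indicator (hset k 0)]
    refine lintegral_mono fun ω => ?_
    simp only [Set.indicator_apply, Set.mem_ofPred_eq]
    split_ifs with h
    · obtain ⟨m, h1, h2, h3⟩ := h
      obtain rfl : m = k := by omega
      exact le_mul_of_one_le_right' h3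
    · exact zero_le
  | succ l ih =>
    have hB : MeasurableSet {u : History K k | 1 ≤ N k u} := measurableSet_le measurable_const (hN k)
    have hfirst : ∀ ω, {u | 1 ≤ N k u}.indicator F (H k ω) ≤
        {u | 1 ≤ N k u}.indicator F (H k ω) * N k (H k ω) := fun ω => by
      by_cases h : 1 ≤ N k (H k ω)
      · exact le_mul_of_one_le_right' h
      · simp [h]
    -- The weight `F` restricted to paths that have not crossed at time `k`. Arbitrary weights `F`
    -- play the role of conditioning on the past, which lets the induction start afresh at time `k +
    -- 1`.
    let F' : History K (k + 1) → ℝ≥0∞ := fun u => {u | 1 ≤ N k u}ᶜ.indicator F (Fin.init u)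
    have hinit : ∀ ω, (Fin.init (H (k + 1) ω) : History K k) = H k ω := fun ω => by
      simp only [hH, history_succ]
      exact Fin.init_snoc _ _
    have hF' : Measurable F' := by
      refine (hF.indicator hB.compl).comp ?_
      exact measurable_pi_iff.2 fun ℓ => measurable_pi_apply ℓ.castSucc
    have ih' := ih (k + 1) (fun m h1 h2 => hstep m (by omega) (by omega)) hF'
    simp only [F', hinit] at ih'
    have hFH : Measurable fun ω => {u | 1 ≤ N k u}.indicator F (H k ω) :=
      (hF.indicator hB).comp (hHm k)
    have hst := hstep k le_rfl (by omega) _ (hF.indicator hB.compl)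
    calc _ ≤ ∫⁻ ω, {u | 1 ≤ N k u}.indicator F (H k ω) ∂P +
        ∫⁻ ω in {ω | ∃ m, k + 1 ≤ m ∧ m ≤ k + 1 + l ∧ 1 ≤ N m (H m ω)},
          {u | 1 ≤ N k u}ᶜ.indicator F (H k ω) ∂P := by
          rw [← lintegral_indicator (hset k _), ← lintegral_indicator (hset (k + 1) l),
            ← lintegral_add_left hFH]
          refine lintegral_mono fun ω => ?_
          by_cases h : 1 ≤ N k (H k ω)
          · refine le_add_right ?_
            simp only [Set.indicator_apply, Set.mem_ofPred_eq, h, if_true]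
            split_ifs <;> simp
          · simp only [Set.indicator_apply, Set.mem_ofPred_eq, h, if_false, Set.mem_compl_iff,
              not_false_iff, if_true, zero_add]
            split_ifs with h1 h2 <;> simp
            obtain ⟨m, h3, h4, h5⟩ := h1
            rcases h3.eq_or_lt with rfl | h3
            · exact absurd h5 h
            · exact absurd ⟨m, h3, by omega, h5⟩ h2
      _ ≤ ∫⁻ ω, {u | 1 ≤ N k u}.indicator F (H k ω) * N k (H k ω) ∂P +
          ∫⁻ ω, {u | 1 ≤ N k u}ᶜ.indicator F (H k ω) * N k (H k ω) ∂P :=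
          add_le_add (lintegral_mono hfirst) (ih'.trans hst)
      _ = _ := by
          have hFN : Measurable fun ω => {u | 1 ≤ N k u}.indicator F (H k ω) * N k (H k ω) :=
            hFH.mul ((hN k).comp (hHm k))
          rw [← lintegral_add_left hFN]
          refine lintegral_congr fun ω => ?_
          rw [← add_mul]
          congr 1
          exact congrFun (Set.indicator_self_add_compl _ F) _

end

/-! ### Lower-tail bounds for the sum of squared deviations -/

/-- The exponential process `exp (m (1 - z) / 2 - (1 - z) / (z v) * S)`, where `S` is the sum of
the squared deviations of the first `m` rewards. -/
noncomputable def expProcess (K : ℕ) (z v : ℝ) (m : ℕ) (h : History K m) : ℝ≥0∞ :=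
  ENNReal.ofReal (Real.exp (m * (1 - z) / 2 - (1 - z) / (z * v) * sumSqDev h))

lemma measurable_expProcess (K : ℕ) (z v : ℝ) (m : ℕ) : Measurable (expProcess K z v m) := by
  have := measurable_sumSqDev (K := K) (m := m)
  unfold expProcess
  fun_prop

lemma one_le_expProcess {K m : ℕ} {z v : ℝ} (hz : z ∈ Set.Ioo (0 : ℝ) 1) (hv : 0 < v)
    {h : History K m} (hS : sumSqDev h < m * z * v / 2) : 1 ≤ expProcess K z v m h := by
  have h1 : 0 < 1 - z := by linarith [hz.2]
  have h2 : 0 < z * v := mul_pos hz.1 hv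
  rw [expProcess, ENNReal.one_le_ofReal, Real.one_le_exp_iff, sub_nonneg, div_mul_eq_mul_div,
    div_le_iff₀ h2]
  nlinarith

section

variable {K d : ℕ} [NeZero K] {x : Fin K → Fin d → ℝ} {θ : Fin d → ℝ} {v : ℝ≥0} {n : ℕ}
  {z α lam : ℝ} {tie : ℕ → Finset (Fin K) → Fin K}
  {Ω : Type*} [MeasurableSpace Ω] {P : Measure Ω} [IsProbabilityMeasure P]
  {Y : Fin K → ℕ → Ω → ℝ} {J : (m : ℕ) → Fin m → Fin m × Bool}

/-- The Gaussian bound gives the exact denominator `z + 2(1-z) m/(m+1)`, which is at least `1` for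
`m ≥ 1`. The free lower bound `q` allows `1` in general and a sharper value where it is needed. -/
lemma lintegral_expProcess_succ_le (hz : z ∈ Set.Ioo (0 : ℝ) 1) (hv : v ≠ 0)
    (hY : ∀ i s, Measurable (Y i s))
    (hY_law : ∀ (i : Fin K) (s : Fin n), HasLaw (Y i (s + 1)) (gaussianReal (x i ⬝ᵥ θ) v) P)
    (hY_indep : iIndepFun (fun p : Fin K × Fin n => Y p.1 (p.2 + 1)) P)
    {m : ℕ} (hm0 : 0 < m) (hm : m < n) {q : ℝ} (hq0 : 0 < q)
    (hq : q ≤ z + 2 * (1 - z) * (m / (m + 1)))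
    {F : History K m → ℝ≥0∞} (hF : Measurable F) :
    ∫⁻ ω, F (history x n z α lam tie (fun i s => Y i s ω) J m) *
        expProcess K z v (m + 1) (history x n z α lam tie (fun i s => Y i s ω) J (m + 1)) ∂P ≤
      ENNReal.ofReal √(z * Real.exp (1 - z) / q) *
      ∫⁻ ω, F (history x n z α lam tie (fun i s => Y i s ω) J m) *
        expProcess K z v m (history x n z α lam tie (fun i s => Y i s ω) J m) ∂P := by
  obtain ⟨hz0, hz1⟩ := hz
  have h1z : 0 < 1 - z := by linarith
  have hv' : (0 : ℝ) < v := by positivity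
  -- `c / v` is the coefficient of the squared deviation in the exponent after `sumSqDev_snoc`.
  let c : ℝ≥0 := ⟨(1 - z) / z * (m / (m + 1)), by positivity⟩
  have hc : (c : ℝ) = (1 - z) / z * (m / (m + 1)) := rfl
  let g : ℝ → ℝ≥0∞ := fun y => ENNReal.ofReal (Real.exp ((1 - z) / 2)) *
    ENNReal.ofReal (Real.exp (-(c / v * y ^ 2)))
  have hg : Measurable g := by fun_prop
  have hC : ∀ μ b, ∫⁻ y, g (y - b) ∂gaussianReal μ v ≤
      ENNReal.ofReal √(z * Real.exp (1 - z) / q) := fun μ b => by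
    simp only [g]
    rw [lintegral_const_mul _ (by fun_prop)]
    refine (mul_le_mul_right (lintegral_exp_gaussianReal_le hv c μ b) _).trans ?_
    rw [← ENNReal.ofReal_mul (by positivity), Real.exp_half, ← Real.sqrt_inv,
      ← Real.sqrt_mul (by positivity)]
    refine ENNReal.ofReal_le_ofReal (Real.sqrt_le_sqrt ?_)
    rw [mul_comm z, mul_div_assoc]
    refine mul_le_mul_of_nonneg_left ?_ (by positivity)
    rw [inv_eq_one_div, div_le_div_iff₀ (by positivity) hq0, hc]
    have : z * (1 + 2 * ((1 - z) / z * (m / (m + 1)))) = z + 2 * (1 - z) * (m / (m + 1)) := by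
      field_simp
    linarith
  have key := lintegral_history_mul_le (x := x) (z := z) (α := α) (lam := lam) (tie := tie)
    (J := J) hY hY_law hY_indep hm (hF.mul (measurable_expProcess K z v m)) hg hC
  refine le_trans (le_of_eq (lintegral_congr fun ω => ?_)) key
  rw [Pi.mul_apply, mul_assoc]
  congr 1
  simp only [expProcess, g, history_succ, sumSqDev_snoc hm0, Fin.snoc_last]
  rw [← ENNReal.ofReal_mul (by positivity), ← ENNReal.ofReal_mul (by positivity),
    ← Real.exp_add, ← Real.exp_add, hc]
  congr 2
  push_cast
  field_simp
  ring

lemma exp_half_eq (hz : 0 < z) : Real.exp ((1 - z) / 2) = √(z * Real.exp (1 - z)) / √z := by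
  rw [Real.sqrt_mul hz.le, mul_div_cancel_left₀ _ (Real.sqrt_pos.2 hz).ne', Real.exp_half]

lemma lintegral_expProcess_le (hz : z ∈ Set.Ioo (0 : ℝ) 1) (hv : v ≠ 0)
    (hY : ∀ i s, Measurable (Y i s))
    (hY_law : ∀ (i : Fin K) (s : Fin n), HasLaw (Y i (s + 1)) (gaussianReal (x i ⬝ᵥ θ) v) P)
    (hY_indep : iIndepFun (fun p : Fin K × Fin n => Y p.1 (p.2 + 1)) P)
    {m : ℕ} (hm : 3 ≤ m) (hmn : m ≤ n) :
    ∫⁻ ω, expProcess K z v m (history x n z α lam tie (fun i s => Y i s ω) J m) ∂P ≤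
      ENNReal.ofReal (√(z * Real.exp (1 - z)) ^ m / √(z * (1 + (1 - z) / 3))) := by
  have hz0 := hz.1
  have h1z : 0 < 1 - z := by linarith [hz.2]
  have hs := fun {m : ℕ} (hm0 : 0 < m) (hm : m < n) {q : ℝ} (hq0 : 0 < q)
    (hq : q ≤ z + 2 * (1 - z) * (m / (m + 1))) =>
    lintegral_expProcess_succ_le (x := x) (α := α) (lam := lam) (tie := tie)
      (J := J) hz hv hY hY_law hY_indep hm0 hm hq0 hq (F := fun _ => 1) measurable_const
  simp only [one_mul] at hs
  induction m, hm using Nat.le_induction with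
  | base =>
    -- A single reward has no deviation from its mean, so the process is deterministic at time `1`.
    have h1 : ∫⁻ ω, expProcess K z v 1 (history x n z α lam tie (fun i s => Y i s ω) J 1) ∂P =
        ENNReal.ofReal (√(z * Real.exp (1 - z)) / √z) := by
      simp [expProcess, sumSqDev_one, exp_half_eq hz0]
    have h2 := hs one_pos (by omega) one_pos (by norm_num; linarith)
    -- At `m = 2` the exact denominator `z + (4/3)(1-z)` is kept; the gain is used in
    -- `sqrt_pow_div_le_one_div` when `m = 3`.
    have h3 := hs (m := 2) two_pos (by omega) (q := 1 + (1 - z) / 3) (by positivity)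
      (by norm_num; linarith)
    rw [h1] at h2
    refine (h3.trans (mul_le_mul_right h2 _)).trans (le_of_eq ?_)
    rw [← ENNReal.ofReal_mul (by positivity), ← ENNReal.ofReal_mul (by positivity), div_one,
      Real.sqrt_div (by positivity), Real.sqrt_mul hz0.le (1 + (1 - z) / 3)]
    congr 1
    field_simp
  | succ m hm ih =>
    have h2 := hs (m := m) (by omega) (by omega) one_pos (by
      have : (1 : ℝ) / 2 ≤ m / (m + 1) := by
        have : (1 : ℝ) ≤ m := by exact_mod_cast (by omega : 1 ≤ m)
        rw [div_le_div_iff₀ two_pos (by positivity)]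
        linarith
      nlinarith)
    refine (h2.trans (mul_le_mul_right (ih (by omega)) _)).trans (le_of_eq ?_)
    rw [← ENNReal.ofReal_mul (by positivity), div_one, pow_succ]
    congr 1
    ring

/-- The probability that the exponential process reaches `1` at some time from `k` to `n - 1`. -/
lemma measure_expProcess_hitting_le (hz : z ∈ Set.Ioo (0 : ℝ) 1) (hv : v ≠ 0)
    (hY : ∀ i s, Measurable (Y i s))
    (hY_law : ∀ (i : Fin K) (s : Fin n), HasLaw (Y i (s + 1)) (gaussianReal (x i ⬝ᵥ θ) v) P)
    (hY_indep : iIndepFun (fun p : Fin K × Fin n => Y p.1 (p.2 + 1)) P)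
    {k : ℕ} (hk : 3 ≤ k) (hkn : k ≤ n) :
    P {ω | ∃ m, k ≤ m ∧ m < n ∧
        sumSqDev (history x n z α lam tie (fun i s => Y i s ω) J m) < m * z * v / 2} ≤
      ENNReal.ofReal (√(z * Real.exp (1 - z)) ^ k / √(z * (1 + (1 - z) / 3))) := by
  have h1z : 0 < 1 - z := by linarith [hz.2]
  have hL : z * Real.exp (1 - z) ≤ 1 := by
    have h2 : z ≤ Real.exp (z - 1) := by linarith [Real.add_one_le_exp (z - 1)]
    calc z * Real.exp (1 - z) ≤ Real.exp (z - 1) * Real.exp (1 - z) := by gcongr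
      _ = 1 := by rw [← Real.exp_add]; simp
  have hV := lintegral_hitting_le (x := x) (n := n) (z := z) (α := α) (lam := lam) (tie := tie)
    (J := J) (P := P) hY (measurable_expProcess K z v) (n - k) k (fun m h1 h2 F hF => by
      refine (lintegral_expProcess_succ_le hz hv hY hY_law hY_indep (by omega) (by omega) one_pos
        ?_ hF).trans (mul_le_of_le_one_left' ?_)
      · have : (1 : ℝ) / 2 ≤ m / (m + 1) := by
          have : (1 : ℝ) ≤ m := by exact_mod_cast (by omega : 1 ≤ m)
          rw [div_le_div_iff₀ two_pos (by positivity)]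
          linarith
        nlinarith
      · rw [div_one, ENNReal.ofReal_le_one]
        exact Real.sqrt_le_one.2 hL) (F := fun _ => 1) measurable_const
  simp only [one_mul, setLIntegral_one] at hV
  refine (measure_mono ?_).trans
    (hV.trans (lintegral_expProcess_le hz hv hY hY_law hY_indep hk hkn))
  rintro ω ⟨m, h1, h2, h3⟩
  exact ⟨m, h1, by omega, one_le_expProcess hz (by positivity) h3⟩

/-- With two rewards `S_2 = (Y_2 - Y_1)²/2`, so the event confines the second reward to an interval
of radius `√(3zv)` around the first, and the Gaussian density is at most `1/√(2πv)`. The threshold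
is the one for time `3`, so that times `2` and `3` are covered together. -/
lemma measure_sumSqDev_two_lt_le (hz : 0 < z) (hv : v ≠ 0) (hY : ∀ i s, Measurable (Y i s))
    (hY_law : ∀ (i : Fin K) (s : Fin n), HasLaw (Y i (s + 1)) (gaussianReal (x i ⬝ᵥ θ) v) P)
    (hY_indep : iIndepFun (fun p : Fin K × Fin n => Y p.1 (p.2 + 1)) P) (hn : 2 ≤ n) :
    P {ω | sumSqDev (history x n z α lam tie (fun i s => Y i s ω) J 2) < 3 * z * v / 2} ≤
      ENNReal.ofReal √(6 * z / Real.pi) := by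
  have hv' : (0 : ℝ) < v := by positivity
  set r : ℝ := √(3 * z * v) with hr
  have hrr : r ^ 2 = 3 * z * v := Real.sq_sqrt (by positivity)
  have hr0 : 0 < r := Real.sqrt_pos.2 (by positivity)
  have hC : ∀ μ b, ∫⁻ y, (Metric.ball (0 : ℝ) r).indicator 1 (y - b) ∂gaussianReal μ v ≤
      ENNReal.ofReal √(6 * z / Real.pi) := fun μ b => by
    have : ∀ y, (Metric.ball (0 : ℝ) r).indicator (1 : ℝ → ℝ≥0∞) (y - b) =
        (Metric.ball b r).indicator 1 y := fun y => by
      classical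
      simp [Set.indicator_apply, Real.dist_eq]
    rw [lintegral_congr this, lintegral_indicator_one Metric.isOpen_ball.measurableSet]
    refine (gaussianReal_ball_le hv μ b r).trans (ENNReal.ofReal_le_ofReal (le_of_eq ?_))
    rw [eq_comm, Real.sqrt_eq_iff_mul_self_eq (by positivity) (by positivity)]
    have hpi : √(2 * Real.pi * v) ^ 2 = 2 * Real.pi * v := Real.sq_sqrt (by positivity)
    rw [← sq, mul_pow, mul_pow, hrr, inv_pow, hpi]
    field_simp
    norm_num
  have key := lintegral_history_mul_le (x := x) (z := z) (α := α) (lam := lam) (tie := tie)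
    (J := J) hY hY_law hY_indep (m := 1) (by omega) (F := fun _ => 1) measurable_const
    (measurable_one.indicator Metric.isOpen_ball.measurableSet) hC
  simp only [one_mul, lintegral_const, measure_univ, mul_one] at key
  refine le_trans ?_ key
  have hset : MeasurableSet {ω | sumSqDev (history x n z α lam tie (fun i s => Y i s ω) J 2) <
      3 * z * v / 2} :=
    measurableSet_lt (measurable_sumSqDev.comp (measurable_history x n z α lam tie hY J 2))
      measurable_const
  rw [← lintegral_indicator_one hset]
  refine lintegral_mono fun ω => ?_
  refine Set.indicator_apply_le' (fun hω => ?_) fun _ => zero_le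
  rw [Set.indicator_of_mem, Pi.one_apply]
  · exact le_rfl
  rw [mem_ball_zero_iff, Real.norm_eq_abs]
  refine abs_lt_of_sq_lt_sq ?_ hr0.le
  rw [Set.mem_ofPred_eq, history_succ, sumSqDev_snoc one_pos, sumSqDev_one] at hω
  rw [hrr, history_succ, Fin.snoc_last]
  norm_num at hω ⊢
  linarith

/-! ### Numerical comparisons with `1 / n` -/

/-- Put `a = √L ^ m` and `q = 1 + (1-z)/3`. Since `a N² ≤ 1`, it suffices that `a ≤ z q`, that is,
`L^(m-2) e^(2(1-z)) ≤ q²`. For `m ≥ 4` one has `L^(m-2) ≤ 1/N² ≤ 1/25`, which beats `e²`. For `m =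
3` only `L < 0.16` is used, and `q ≥ 1.28` absorbs the rest. -/
lemma sqrt_pow_div_le_one_div {z N : ℝ} {m : ℕ} (hz : z ∈ Set.Ioo (0 : ℝ) 1) (hm : 3 ≤ m)
    (hN : (m : ℝ) + 1 ≤ N) (hL : N ^ 4 * (z * Real.exp (1 - z)) ^ m < 1) :
    √(z * Real.exp (1 - z)) ^ m / √(z * (1 + (1 - z) / 3)) ≤ 1 / N := by
  obtain ⟨hz0, hz1⟩ := hz
  have h1z : 0 < 1 - z := by linarith
  set L := z * Real.exp (1 - z) with hLdef
  set q := 1 + (1 - z) / 3 with hq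
  have hL0 : 0 < L := by positivity
  have hq1 : 1 ≤ q := by linarith
  have hm3 : (3 : ℝ) ≤ m := by exact_mod_cast hm
  have hN0 : 0 < N := by linarith
  have he : Real.exp (1 - z) ^ 2 ≤ 7.4 := by
    have h1 : Real.exp (1 - z) ≤ 2.72 := by
      have := Real.exp_le_exp.2 (by linarith : 1 - z ≤ 1)
      linarith [Real.exp_one_lt_d9]
    nlinarith [Real.exp_pos (1 - z)]
  have hzL : z ≤ L := by
    have := Real.one_le_exp h1z.le
    nlinarith
  have hpow : L ^ (m - 2) * Real.exp (1 - z) ^ 2 ≤ q ^ 2 := by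
    rcases hm.eq_or_lt with rfl | hm4
    · have hN4 : (4 : ℝ) ≤ N := by norm_num at hN; linarith
      have h256 : (256 : ℝ) ≤ N ^ 4 := by
        calc (256 : ℝ) = 4 ^ 4 := by norm_num
          _ ≤ N ^ 4 := by gcongr
      have hL16 : L < 0.16 := by
        by_contra! h
        have : (0.16 : ℝ) ^ 3 ≤ L ^ 3 := by gcongr
        nlinarith
      have : (1.28 : ℝ) ≤ q := by linarith
      norm_num
      nlinarith
    · have hm5 : (5 : ℝ) ≤ N := by
        have : (4 : ℝ) ≤ m := by exact_mod_cast hm4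
        linarith
      have hN2 : (25 : ℝ) ≤ N ^ 2 := by nlinarith
      have hL1 : L < 1 := by
        by_contra! h
        have h1 : 1 ≤ L ^ m := one_le_pow₀ h
        have h2 : 1 ≤ N ^ 4 := one_le_pow₀ (by linarith)
        exact absurd hL (one_le_mul_of_one_le_of_one_le h2 h1).not_gt
      have h1 : L ^ (m - 2) * N ^ 2 ≤ 1 := by
        rw [← sq_le_one_iff₀ (by positivity)]
        calc (L ^ (m - 2) * N ^ 2) ^ 2 = N ^ 4 * L ^ ((m - 2) * 2) := by ring
          _ ≤ N ^ 4 * L ^ m := by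
              gcongr N ^ 4 * ?_
              exact pow_le_pow_of_le_one hL0.le hL1.le (by omega)
          _ ≤ 1 := hL.le
      have h2 : L ^ (m - 2) ≤ 1 / 25 := by
        have : 0 < L ^ (m - 2) := by positivity
        nlinarith
      nlinarith [sq_nonneg (Real.exp (1 - z))]
  have hmul : L ^ m ≤ (z * q) ^ 2 := by
    calc L ^ m = L ^ (m - 2) * L ^ 2 := by rw [← pow_add]; congr 1; omega
      _ = z ^ 2 * (L ^ (m - 2) * Real.exp (1 - z) ^ 2) := by rw [hLdef]; ring
      _ ≤ z ^ 2 * q ^ 2 := by gcongr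
      _ = _ := by ring
  set a := √L ^ m with ha
  have ha0 : 0 < a := by positivity
  have ha2 : a ^ 2 = L ^ m := by rw [ha, ← pow_mul, mul_comm, pow_mul, Real.sq_sqrt hL0.le]
  have haq : a ≤ z * q := by
    rw [← ha2] at hmul
    exact (pow_le_pow_iff_left₀ ha0.le (by positivity) two_ne_zero).1 hmul
  have haN : a * N ^ 2 ≤ 1 := by
    rw [← sq_le_one_iff₀ (by positivity), mul_pow, ha2]
    nlinarith
  rw [div_le_div_iff₀ (by positivity) hN0, one_mul]
  refine Real.le_sqrt_of_sq_le ?_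
  nlinarith

/-- Together with `sqrt_pow_four_div_le` this splits the budget `√L ≤ 1/n` as `0.9 + 0.1` between
times `2, 3` and times from `4` on. The thresholds `1/9` and `1/25` are `1/n²` for `n = 3` and `n =
5`. -/
lemma sqrt_six_mul_div_pi_le {z : ℝ} (hz : z ∈ Set.Ioo (0 : ℝ) 1)
    (hL : z * Real.exp (1 - z) ≤ 1 / 9) :
    √(6 * z / Real.pi) ≤ 0.9 * √(z * Real.exp (1 - z)) := by
  obtain ⟨hz0, hz1⟩ := hz
  have hzL : z ≤ 1 / 9 := by
    have := Real.one_le_exp (by linarith : 0 ≤ 1 - z)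
    nlinarith
  have he : 2.4 ≤ Real.exp (1 - z) := by
    have h1 : Real.exp (1 - z) = Real.exp 1 * Real.exp (-z) := by rw [← Real.exp_add]; ring_nf
    have h2 := Real.add_one_le_exp (-z)
    have h3 := Real.exp_one_gt_d9
    rw [h1]
    nlinarith
  have hpi := Real.pi_gt_d2
  refine Real.sqrt_le_iff.2 ⟨by positivity, ?_⟩
  rw [mul_pow, Real.sq_sqrt (by positivity), div_le_iff₀ Real.pi_pos]
  have : 2.4 * 3.14 ≤ Real.exp (1 - z) * Real.pi := by gcongr
  nlinarith

lemma sqrt_pow_four_div_le {z : ℝ} (hz : z ∈ Set.Ioo (0 : ℝ) 1)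
    (hL : z * Real.exp (1 - z) ≤ 1 / 25) :
    √(z * Real.exp (1 - z)) ^ 4 / √(z * (1 + (1 - z) / 3)) ≤ 0.1 * √(z * Real.exp (1 - z)) := by
  obtain ⟨hz0, hz1⟩ := hz
  have h1z : 0 < 1 - z := by linarith
  set L := z * Real.exp (1 - z) with hLdef
  have hL0 : 0 < L := by positivity
  have he : Real.exp (1 - z) ≤ 2.72 := by
    have := Real.exp_le_exp.2 (by linarith : 1 - z ≤ 1)
    linarith [Real.exp_one_lt_d9]
  have h3 : √L ^ 3 ≤ 0.1 * √(z * (1 + (1 - z) / 3)) := by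
    have h1 : (√L ^ 3) ^ 2 ≤ (0.1 * √(z * (1 + (1 - z) / 3))) ^ 2 := by
      rw [mul_pow, Real.sq_sqrt (by positivity), ← pow_mul, mul_comm, pow_mul,
        Real.sq_sqrt hL0.le]
      calc L ^ 3 = L ^ 2 * (z * Real.exp (1 - z)) := by ring
        _ ≤ (1 / 25) ^ 2 * (z * 2.72) := by gcongr
        _ ≤ _ := by nlinarith [mul_pos hz0 h1z]
    exact (pow_le_pow_iff_left₀ (by positivity) (by positivity) two_ne_zero).1 h1
  rw [div_le_iff₀ (by positivity)]
  have := mul_le_mul_of_nonneg_left h3 (Real.sqrt_nonneg L)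
  linarith [this, pow_succ' √L 3]

end

/-- The condition on the round, in multiplicative form. -/
lemma pow_four_mul_pow_lt_one {z : ℝ} (hz : 0 < z) {n m : ℕ} (hn : 0 < n)
    (h : 4 * Real.log n < m * (z - 1 - Real.log z)) :
    (n : ℝ) ^ 4 * (z * Real.exp (1 - z)) ^ m < 1 := by
  have hL : z * Real.exp (1 - z) = Real.exp (-(z - 1 - Real.log z)) := by
    rw [show -(z - 1 - Real.log z) = Real.log z + (1 - z) by ring, Real.exp_add, Real.exp_log hz]
  have hN : (n : ℝ) ^ 4 = Real.exp (4 * Real.log n) := by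
    rw [← Real.exp_log (by positivity : (0 : ℝ) < n), ← Real.exp_nat_mul, Real.log_exp]
    norm_num
  rw [hL, hN, ← Real.exp_nat_mul, ← Real.exp_add, Real.exp_lt_one_iff]
  linarith

/-! ### Assembly for fixed draws -/

section

variable {K d : ℕ} [NeZero K] {x : Fin K → Fin d → ℝ} {θ : Fin d → ℝ} {v : ℝ≥0} {n : ℕ}
  {z α lam : ℝ} {tie : ℕ → Finset (Fin K) → Fin K}
  {Ω : Type*} [MeasurableSpace Ω] {P : Measure Ω} [IsProbabilityMeasure P]
  {Y : Fin K → ℕ → Ω → ℝ} {J : (m : ℕ) → Fin m → Fin m × Bool}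

/-- For fixed draws, the probability that the sum of the squared deviations is too small after
some number of rounds is at most `1 / n`. -/
lemma measure_exists_sumSqDev_lt_le (hz : z ∈ Set.Ioo (0 : ℝ) 1) (hv : v ≠ 0)
    (hY : ∀ i s, Measurable (Y i s))
    (hY_law : ∀ (i : Fin K) (s : Fin n), HasLaw (Y i (s + 1)) (gaussianReal (x i ⬝ᵥ θ) v) P)
    (hY_indep : iIndepFun (fun p : Fin K × Fin n => Y p.1 (p.2 + 1)) P) :
    P {ω | ∃ m, (2 ≤ m ∧ m < n ∧ 4 * Real.log n < m * (z - 1 - Real.log z)) ∧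
        sumSqDev (history x n z α lam tie (fun i s => Y i s ω) J m) < m * z * v / 2} ≤
      ENNReal.ofReal (1 / n) := by
  classical
  by_cases hex : ∃ m : ℕ, 2 ≤ m ∧ m < n ∧ 4 * Real.log n < m * (z - 1 - Real.log z)
  swap
  · rw [show {ω | ∃ m, (2 ≤ m ∧ m < n ∧ 4 * Real.log n < m * (z - 1 - Real.log z)) ∧
        sumSqDev (history x n z α lam tie (fun i s => Y i s ω) J m) < m * z * v / 2} = ∅ from
      Set.eq_empty_of_forall_notMem fun ω ⟨m, hm, _⟩ => hex ⟨m, hm⟩, measure_empty]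
    exact zero_le
  obtain ⟨h2, hn, hlog⟩ := Nat.find_spec hex
  have hmin : ∀ m, (2 ≤ m ∧ m < n ∧ 4 * Real.log n < m * (z - 1 - Real.log z)) →
      Nat.find hex ≤ m := fun m hm => Nat.find_min' hex hm
  set k := Nat.find hex
  have hL := pow_four_mul_pow_lt_one hz.1 (by omega) hlog
  have hn0 : (0 : ℝ) < n := by exact_mod_cast (by omega : 0 < n)
  have hvpos : (0 : ℝ) < v := by positivity
  rcases h2.eq_or_lt with hk | hk
  -- First relevant time `2`: here `n⁴ L² < 1` gives only `√L < 1/n`, while the exponential bound at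
  -- time `2` would be `√L` times `e^((1-z)/2)`.
  · rw [← hk] at hL hn
    set L := z * Real.exp (1 - z) with hLdef
    have hL0 : 0 < L := mul_pos hz.1 (Real.exp_pos _)
    have hnL : n * √L < 1 := by
      refine lt_of_pow_lt_pow_left₀ 4 zero_le_one ?_
      calc (n * √L) ^ 4 = n ^ 4 * (√L ^ 2) ^ 2 := by ring
        _ = n ^ 4 * L ^ 2 := by rw [Real.sq_sqrt hL0.le]
        _ < 1 ^ 4 := by simpa using hL
    have hLn : √L ≤ 1 / n := by
      rw [le_div_iff₀ hn0]
      linarith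
    have hLsq : ∀ N : ℕ, 0 < N → N ≤ n → L ≤ 1 / (N : ℝ) ^ 2 := fun N hN0 hN => by
      have hN' : (0 : ℝ) < N := by exact_mod_cast hN0
      have hNn : (N : ℝ) ≤ n := by exact_mod_cast hN
      have h1 : √L ≤ 1 / N := hLn.trans (one_div_le_one_div_of_le hN' hNn)
      calc L = √L ^ 2 := (Real.sq_sqrt hL0.le).symm
        _ ≤ (1 / N) ^ 2 := by gcongr
        _ = _ := by ring
    have hA := (measure_sumSqDev_two_lt_le (x := x) (α := α) (lam := lam) (tie := tie) (J := J)
      hz.1 hv hY hY_law hY_indep (by omega)).trans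
      (ENNReal.ofReal_le_ofReal (sqrt_six_mul_div_pi_le hz (by
        have := hLsq 3 (by norm_num) hn
        norm_num at this ⊢
        exact this)))
    have hB : P {ω | ∃ m, 4 ≤ m ∧ m < n ∧
        sumSqDev (history x n z α lam tie (fun i s => Y i s ω) J m) < m * z * v / 2} ≤
        ENNReal.ofReal (0.1 * √L) := by
      by_cases h5 : 5 ≤ n
      · refine (measure_expProcess_hitting_le hz hv hY hY_law hY_indep (by norm_num)
          (by omega)).trans (ENNReal.ofReal_le_ofReal (sqrt_pow_four_div_le hz ?_))
        have := hLsq 5 (by norm_num) h5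
        norm_num at this ⊢
        exact this
      · rw [Set.eq_empty_of_forall_notMem (s := {ω | ∃ m, 4 ≤ m ∧ m < n ∧ sumSqDev
          (history x n z α lam tie (fun i s => Y i s ω) J m) < m * z * v / 2})
          fun ω ⟨m, h1, h2, _⟩ => by omega, measure_empty]
        exact zero_le
    refine (measure_mono ?_).trans ((measure_union_le _ _).trans ((add_le_add hA hB).trans ?_))
    -- Violations at times `2` and `3` both force `S_2 < 3zv/2`, because `S_2 ≤ S_3`.
    · rintro ω ⟨m, ⟨hm2, hmn, -⟩, hS⟩
      rcases lt_or_ge m 4 with h4 | h4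
      · left
        have hzv : 0 < z * v := mul_pos hz.1 hvpos
        simp only [Set.mem_ofPred_eq]
        obtain rfl | rfl : m = 2 ∨ m = 3 := by omega
        · push_cast at hS
          nlinarith
        · rw [history_succ, sumSqDev_snoc two_pos] at hS
          push_cast at hS
          refine lt_of_le_of_lt ?_ hS
          exact le_add_of_nonneg_right (by positivity)
      · exact Or.inr ⟨m, h4, hmn, hS⟩
    · rw [← ENNReal.ofReal_add (by positivity) (by positivity)]
      refine ENNReal.ofReal_le_ofReal ?_
      linarith
  · refine (measure_mono ?_).trans ((measure_expProcess_hitting_le (x := x) (α := α) (lam := lam)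
      (tie := tie) (J := J) hz hv hY hY_law hY_indep hk hn.le).trans
      (ENNReal.ofReal_le_ofReal (sqrt_pow_div_le_one_div hz hk (by exact_mod_cast hn) hL)))
    rintro ω ⟨m, hm, hS⟩
    exact ⟨m, hmin m hm, hm.2.1, hS⟩

end

/-! ### From fixed draws to random draws -/

/-- If the event `{ω | B (Y ω) (J ω)}` has conditional probability at most `ε` for every fixed
value of a finitely valued `J` independent of `Y`, then its probability is at most `ε`. -/
lemma measure_le_of_indepFun_fintype {Ω E ι : Type*} [MeasurableSpace Ω] [MeasurableSpace E]
    [Fintype ι] [MeasurableSpace ι] [MeasurableSingletonClass ι] {P : Measure Ω}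
    [IsProbabilityMeasure P] {Y : Ω → E} {J : Ω → ι} (hY : AEMeasurable Y P)
    (hJ : AEMeasurable J P) (hYJ : IndepFun Y J P) {B : E → ι → Prop}
    (hB : ∀ j, MeasurableSet {y | B y j}) {ε : ℝ≥0∞} (hε : ∀ j, P.map Y {y | B y j} ≤ ε) :
    P {ω | B (Y ω) (J ω)} ≤ ε := by
  have : IsProbabilityMeasure (P.map J) := Measure.isProbabilityMeasure_map hJ
  have hsub : {ω | B (Y ω) (J ω)} ⊆ ⋃ j ∈ Finset.univ, Y ⁻¹' {y | B y j} ∩ J ⁻¹' {j} :=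
    fun ω hω => by simpa using hω
  calc P {ω | B (Y ω) (J ω)} ≤ ∑ j, P (Y ⁻¹' {y | B y j} ∩ J ⁻¹' {j}) :=
        (measure_mono hsub).trans (measure_biUnion_finset_le _ _)
    _ ≤ ∑ j, ε * P.map J {j} := by
        refine Finset.sum_le_sum fun j _ => ?_
        rw [hYJ.measure_inter_preimage_eq_mul _ _ (hB j) (measurableSet_singleton j),
          Measure.map_apply_of_aemeasurable hJ (measurableSet_singleton j)]
        gcongr
        exact (Measure.map_apply_of_aemeasurable hY (hB j)).symm.le.trans (hε j)
    _ = ε := by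
        rw [← Finset.mul_sum, sum_measure_singleton, Finset.coe_univ, measure_univ, mul_one]

end LinCORe

open LinCORe in
theorem mainTheorem2
    {K d : ℕ} [NeZero K] (x : Fin K → Fin d → ℝ) (θ : Fin d → ℝ) (σ : ℝ≥0)
    (n : ℕ) (hn : 2 ≤ n) (z : ℝ) (hz : z ∈ Set.Ioo (0 : ℝ) 1)
    (α : ℝ) (hα : 0 < α) (lam : ℝ) (hlam : 0 < lam)
    (tie : ℕ → Finset (Fin K) → Fin K) (htie : ∀ t s, s.Nonempty → tie t s ∈ s)
    {Ω : Type*} [MeasurableSpace Ω] (P : Measure Ω) [IsProbabilityMeasure P]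
    -- `Y i t` is the reward of arm `i` in round `t`, for `1 ≤ t ≤ n`
    (Y : Fin K → ℕ → Ω → ℝ)
    (hY_law : ∀ (i : Fin K) (s : Fin n),
      HasLaw (Y i (s + 1)) (gaussianReal (x i ⬝ᵥ θ) (σ ^ 2)) P)
    (hY_indep : iIndepFun (fun p : Fin K × Fin n => Y p.1 (p.2 + 1)) P)
    -- `J m ℓ` is the uniformly random pool position of the `ℓ`-th draw in round `m + 1 ≤ n`
    (J : (m : ℕ) → Fin m → Ω → Fin m × Bool)
    (hJ_law : ∀ (m : Fin n) (ℓ : Fin m), HasLaw (J m ℓ) (uniformOn Set.univ) P)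
    (hJ_indep : iIndepFun (fun p : (m : Fin n) × Fin m => J p.1 p.2) P)
    (hYJ_indep : IndepFun
      (fun ω (p : Fin K × Fin n) => Y p.1 (p.2 + 1) ω)
      (fun ω (p : (m : Fin n) × Fin m) => J p.1 p.2 ω) P) :
    1 - 1 / (n : ℝ) ≤
      P.real {ω | ∀ t : ℕ, 3 ≤ t → t ≤ n → LinCORe.initLength n z < t →
        α ^ 2 * z / 2 * (σ : ℝ) ^ 2 ≤
          LinCORe.drawVariance
            (LinCORe.roundPool x n z α lam tie
              (fun i s => Y i s ω) (fun m ℓ => J m ℓ ω) t)} := by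
  classical
  set G : Set Ω := {ω | ∀ t : ℕ, 3 ≤ t → t ≤ n → LinCORe.initLength n z < t →
        α ^ 2 * z / 2 * (σ : ℝ) ^ 2 ≤
          LinCORe.drawVariance
            (LinCORe.roundPool x n z α lam tie
              (fun i s => Y i s ω) (fun m ℓ => J m ℓ ω) t)} with hG
  have hn0 : (0 : ℝ) < n := by exact_mod_cast (by omega : 0 < n)
  suffices hbad : P Gᶜ ≤ ENNReal.ofReal (1 / n) by
    have h1 : P.real Gᶜ ≤ 1 / n := ENNReal.toReal_le_of_le_ofReal (by positivity) hbad
    have h2 := measureReal_union_le (μ := P) G Gᶜ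
    rw [Set.union_compl_self, probReal_univ] at h2
    linarith
  -- Without noise the bound is `0 ≤` variance; the Gaussian densities need `σ ≠ 0`.
  rcases eq_or_ne σ 0 with rfl | hσ
  · have hGuniv : G = Set.univ := by
      refine Set.eq_univ_of_forall fun ω t _ _ _ => ?_
      rw [roundPool, drawVariance_rewardPool]
      have := sumSqDev_nonneg (history x n z α lam tie (fun i s => Y i s ω)
        (fun m ℓ => J m ℓ ω) (t - 1))
      simp only [NNReal.coe_zero, ne_eq, OfNat.ofNat_ne_zero, not_false_eq_true, zero_pow,
        mul_zero]
      positivity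
    simp [hGuniv]
  have hv : σ ^ 2 ≠ 0 := pow_ne_zero _ hσ
  -- The rewards are only almost everywhere measurable and constrained only in rounds `1` to `n`.
  -- The argument therefore runs on the law of the reward table, with coordinate maps extended by
  -- `0`.
  let yExt : Fin K → ℕ → (Fin K × Fin n → ℝ) → ℝ := fun i s e =>
    if h : 1 ≤ s ∧ s ≤ n then e (i, ⟨s - 1, by omega⟩) else 0
  have hyExt : ∀ i s, Measurable (yExt i s) := fun i s => by
    by_cases h : 1 ≤ s ∧ s ≤ n
    · simp only [yExt, h, dif_pos, and_self]
      exact measurable_pi_apply _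
    · simp only [yExt, h, dif_neg, not_false_iff]
      exact measurable_const
  have hyExt_succ : ∀ i (s : Fin n), yExt i (s + 1) = fun e => e (i, s) := fun i s => by
    have h : 1 ≤ s.val + 1 ∧ s.val + 1 ≤ n := ⟨by omega, s.2⟩
    funext e
    simp [yExt]
  let jExt : ((p : (m : Fin n) × Fin m) → Fin p.1 × Bool) → (m : ℕ) → Fin m → Fin m × Bool :=
    fun j m ℓ => if h : m < n then j ⟨⟨m, h⟩, ℓ⟩ else (ℓ, true)
  let Yv : Ω → Fin K × Fin n → ℝ := fun ω p => Y p.1 (p.2 + 1) ω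
  let Jv : Ω → (p : (m : Fin n) × Fin m) → Fin p.1 × Bool := fun ω p => J p.1 p.2 ω
  have hYv : AEMeasurable Yv P := aemeasurable_pi_lambda _ fun p => (hY_law p.1 p.2).aemeasurable
  have hJv : AEMeasurable Jv P := aemeasurable_pi_lambda _ fun p => (hJ_law p.1 p.2).aemeasurable
  have hQ : IsProbabilityMeasure (P.map Yv) := Measure.isProbabilityMeasure_map hYv
  let H := fun (e : Fin K × Fin n → ℝ) (j : (p : (m : Fin n) × Fin m) → Fin p.1 × Bool) =>
    history x n z α lam tie (fun i s => yExt i s e) (jExt j)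
  let B := fun (e : Fin K × Fin n → ℝ) (j : (p : (m : Fin n) × Fin m) → Fin p.1 × Bool) =>
    ∃ m, (2 ≤ m ∧ m < n ∧ 4 * Real.log n < m * (z - 1 - Real.log z)) ∧
        sumSqDev (H e j m) < m * z * (σ ^ 2 : ℝ≥0) / 2
  have hBmeas : ∀ j, MeasurableSet {e | B e j} := fun j => by
    simp only [B, measurableSet_setOfPred]
    refine Measurable.exists fun m => measurable_const.and (measurableSet_setOfPred.1 ?_)
    exact measurableSet_lt (measurable_sumSqDev.comp
      (measurable_history x n z α lam tie hyExt (jExt j) m)) measurable_const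
  have hQ_law : ∀ (i : Fin K) (s : Fin n),
      HasLaw (yExt i (s + 1)) (gaussianReal (x i ⬝ᵥ θ) (σ ^ 2)) (P.map Yv) := fun i s => by
    refine ⟨(hyExt _ _).aemeasurable, ?_⟩
    rw [AEMeasurable.map_map_of_aemeasurable (hyExt _ _).aemeasurable hYv, hyExt_succ]
    exact (hY_law i s).map_eq
  have hQ_indep : iIndepFun (fun p : Fin K × Fin n => yExt p.1 (p.2 + 1)) (P.map Yv) := by
    simp only [hyExt_succ]
    have h1 := (iIndepFun_iff_map_fun_eq_pi_map fun p : Fin K × Fin n =>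
      (hY_law p.1 p.2).aemeasurable).1 hY_indep
    have (p : Fin K × Fin n) : IsProbabilityMeasure (P.map (Y p.1 (p.2 + 1))) :=
      Measure.isProbabilityMeasure_map (hY_law p.1 p.2).aemeasurable
    rw [show P.map Yv = _ from h1]
    exact iIndepFun_pi (X := fun _ => id) fun _ => aemeasurable_id
  have hmain := measure_le_of_indepFun_fintype hYv hJv hYJ_indep hBmeas fun j =>
    measure_exists_sumSqDev_lt_le (α := α) (lam := lam) (tie := tie) (J := jExt j) hz hv hyExt
      hQ_law hQ_indep
  refine (measure_mono fun ω hω => ?_).trans hmain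
  simp only [hG, Set.mem_compl_iff, Set.mem_ofPred_eq, not_forall, not_le] at hω
  obtain ⟨t, ht3, htn, htT, hlt⟩ := hω
  obtain ⟨m, rfl⟩ : ∃ m, t = m + 1 := ⟨t - 1, by omega⟩
  have hf : 0 < z - 1 - Real.log z := by
    linarith [Real.log_lt_sub_one_of_pos hz.1 hz.2.ne]
  have hm0 : (0 : ℝ) < m := by exact_mod_cast (by omega : 0 < m)
  refine ⟨m, ⟨by omega, by omega, ?_⟩, ?_⟩
  · rw [initLength] at htT
    push_cast at htT
    exact (div_lt_iff₀ hf).1 (by linarith)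
  · have hH : H (Yv ω) (Jv ω) m =
        history x n z α lam tie (fun i s => Y i s ω) (fun m ℓ => J m ℓ ω) m := by
      refine history_congr x n z α lam tie m (fun i s hs => ?_) fun s hs => ?_
      · exact congrFun (hyExt_succ i ⟨s, by omega⟩) _
      · funext ℓ
        simp [jExt, Jv, (by omega : s < n)]
    rw [hH]
    rw [roundPool, Nat.add_sub_cancel, drawVariance_rewardPool, div_lt_iff₀ hm0] at hlt
    push_cast
    refine lt_of_mul_lt_mul_left ?_ (sq_nonneg α)
    linarith
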